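/- Let $G$ be a finite simple graph, some of whose vertices are colored. Under the color change rule, a colored vertex $v$ may color (force) an uncolored neighbor $u$ if $u$ is the only uncolored neighbor of $v$. A set $B\subseteq V(G)$ is a zero forcing set if, when exactly the vertices of $B$ are colored initially, repeated forces can color all of $V(G)$. For $\ell\ge 0$, $B$ is an $\ell$-leaky forcing set if, for every set $L\subseteq V(G)$ of at most $\ell$ vertices (leaks), repeated forces by vertices outside $L$ can color all of $V(G)$ starting from $B$. Let $Z_0(G)$ and $Z_\ell(G)$ be the least cardinalities of a zero forcing set and of an $\ell$-leaky forcing set, respectively; $G$ is $\ell$-resilient if $Z_\ell(G)=Z_0(G)$. Let $K_n\times P_t$ denote the direct (tensor) product of the complete graph on $n\ge 1$ vertices and the path on $t\ge 1$ vertices: $(g,h)$ and $(g',h')$ are adjacent if and only if $gg'\in E(K_n)$ and $hh'\in E(P_t)$. **Theorem.** Let $n,t\ge 1$. Then \[ Z_0(K_n\times P_t)=\begin{cases}(n-2)t & \text{if } t \text{ is even and } n\ge 3,\\ (n-2)t+2 & \text{if } t \text{ is odd and } n\ge 2.\end{cases} \] Moreover, unless $n=2$ and $t\ge 2$, the graph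 $K_n\times P_t$ is $1$-resilient; in particular, in the two cases above (apart from $n=2$ and $t\ge 2$), $Z_1(K_n\times P_t)$ equals the displayed value of $Z_0(K_n\times P_t)$. -/

import Mathlib

/-- The direct (tensor) product of two simple graphs: `(g, h)` and `(g', h')` are adjacent iff
`g` is adjacent to `g'` in `G` and `h` is adjacent to `h'` in `H`. -/
def SimpleGraph.directProd {V W : Type*} (G : SimpleGraph V) (H : SimpleGraph W) :
    SimpleGraph (V × W) where
  Adj x y := G.Adj x.1 y.1 ∧ H.Adj x.2 y.2
  symm := ⟨fun _ _ h => ⟨h.1.symm, h.2.symm⟩⟩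
  loopless := ⟨fun x h => G.loopless.irrefl x.1 h.1⟩

namespace LeakyForcing

variable {V : Type*}

/-- The color change rule: when `C` is the set of colored vertices, the colored vertex `u` can
force `v`, that is, `v` is the only uncolored neighbor of `u`. -/
def CanForce (G : SimpleGraph V) (C : Finset V) (u v : V) : Prop :=
  u ∈ C ∧ G.Adj u v ∧ v ∉ C ∧ ∀ w, G.Adj u w → w ∉ C → w = v

/-- One step of the process with set of leaks `L`: some vertex that is not a leak forces one of
its neighbors, and the set of colored vertices changes from `C` to `C ∪ {v}`. -/
def Step [DecidableEq V] (G : SimpleGraph V) (L : Finset V) (C D : Finset V) : Prop :=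
  ∃ u v, u ∉ L ∧ CanForce G C u v ∧ D = insert v C

/-- Starting from `B`, finitely many forces by vertices outside `L` color the whole graph. -/
def ForcesAll [Fintype V] [DecidableEq V] (G : SimpleGraph V) (L B : Finset V) : Prop :=
  Relation.ReflTransGen (Step G L) B Finset.univ

/-- `B` is a zero forcing set of `G`. -/
def IsZeroForcingSet [Fintype V] [DecidableEq V] (G : SimpleGraph V) (B : Finset V) : Prop :=
  ForcesAll G ∅ B

/-- `B` is an `ℓ`-leaky forcing set of `G`: it forces the whole graph for every choice of at
most `ℓ` leaks (the leaks are chosen after `B`). -/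
def IsLeakyForcingSet [Fintype V] [DecidableEq V] (G : SimpleGraph V) (l : ℕ)
    (B : Finset V) : Prop :=
  ∀ L : Finset V, L.card ≤ l → ForcesAll G L B

/-- The zero forcing number: the least cardinality of a zero forcing set. -/
noncomputable def zeroForcingNumber [Fintype V] [DecidableEq V] (G : SimpleGraph V) : ℕ :=
  sInf {k | ∃ B : Finset V, IsZeroForcingSet G B ∧ B.card = k}

/-- The `ℓ`-leaky forcing number: the least cardinality of an `ℓ`-leaky forcing set. -/
noncomputable def leakyForcingNumber [Fintype V] [DecidableEq V] (G : SimpleGraph V)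
    (l : ℕ) : ℕ :=
  sInf {k | ∃ B : Finset V, IsLeakyForcingSet G l B ∧ B.card = k}

/-- The least cardinality is taken over a nonempty set: all vertices together always force. -/
theorem isLeakyForcingSet_univ [Fintype V] [DecidableEq V] (G : SimpleGraph V) (l : ℕ) :
    IsLeakyForcingSet G l Finset.univ :=
  fun _ _ => Relation.ReflTransGen.refl

/-- Zero forcing is leaky forcing with no leaks. -/
theorem leakyForcingNumber_zero [Fintype V] [DecidableEq V] (G : SimpleGraph V) :
    leakyForcingNumber G 0 = zeroForcingNumber G := by
  simp [leakyForcingNumber, zeroForcingNumber, IsLeakyForcingSet, IsZeroForcingSet]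

/-- `G` is `ℓ`-resilient: its `ℓ`-leaky forcing number equals its zero forcing number. -/
def IsResilient [Fintype V] [DecidableEq V] (G : SimpleGraph V) (l : ℕ) : Prop :=
  leakyForcingNumber G l = zeroForcingNumber G

end LeakyForcing

/-- The direct product `K_n × P_t` of the complete graph on `n` vertices and the path on `t`
vertices. -/
def completeTimesPath (n t : ℕ) : SimpleGraph (Fin n × Fin t) :=
  (⊤ : SimpleGraph (Fin n)).directProd (SimpleGraph.pathGraph t)

/-! Lower bound: a kernel vector of a matrix supported exactly on the edges propagates zeros along
forces, so a zero forcing set is at least as large as the nullity of any such matrix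
(`IsZeroForcingSet.eq_zero`). For `K_n × P_t` take the matrix with entries `(g' - g) * S i j`, where
`S = pathSign`. It is a difference of two products with `S`, so its rank is at most `2 * rank S`: at
most `2t` in general, and at most `2(t - 1)` for odd `t`, where `S` is singular (`mul_le_card_add`).

Upper bound: a vertex in column `s` has no neighbor in column `s`, so uncolored vertices there do
not obstruct its forces. For odd `t`, a full first layer pushes color forward layer by layer
(`eq_univ_of_first_layer`). For even `t`, even and odd layers omit the overlapping pairs `{b, c}`
and `{a, c}`, and whole columns are filled by sweeping from either end of the path
(`Sweeps.eq_univ`). For `n ≥ 3` a spare column gets around a single leak, so the same sets bound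
`Z_1`. -/

open Finset

namespace LeakyForcing

/-! ### Stalled sets and the kernel bound for zero forcing -/

section General

variable {V : Type*} [Fintype V] [DecidableEq V] {G : SimpleGraph V}

/-- A set of colored vertices at which no vertex outside `L` can force any more. -/
def IsStalled (G : SimpleGraph V) (L C : Finset V) : Prop :=
  ∀ u v, u ∈ C → u ∉ L → G.Adj u v → (∀ w, G.Adj u w → w ∉ C → w = v) → v ∈ C

/-- A reachable set of maximal size is stalled. This replaces explicit forcing sequences by closure
arguments. -/
theorem forcesAll_of_stalled {L B : Finset V}
    (h : ∀ C, B ⊆ C → IsStalled G L C → C = univ) : ForcesAll G L B := by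
  classical
  obtain ⟨C, hC, hmax⟩ := Finset.exists_max_image
    (univ.filter fun C => Relation.ReflTransGen (Step G L) B C) Finset.card
    ⟨B, by simp [Relation.ReflTransGen.refl]⟩
  have hBC : Relation.ReflTransGen (Step G L) B C := by simpa using hC
  have hsub : B ⊆ C := by
    clear hmax hC
    induction hBC with
    | refl => exact subset_rfl
    | tail _ hs ih =>
      obtain ⟨u, v, -, -, rfl⟩ := hs
      exact ih.trans (subset_insert _ _)
  have hst : IsStalled G L C := by
    intro u v hu hL huv hw
    by_contra hv
    have := hmax (insert v C) (by
      simpa using hBC.tail ⟨u, v, hL, ⟨hu, huv, hv, hw⟩, rfl⟩)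
    rw [card_insert_of_notMem hv] at this
    omega
  have := h C hsub hst
  rw [this] at hBC
  exact hBC

theorem zeroForcingNumber_le {B : Finset V} (h : IsZeroForcingSet G B) :
    zeroForcingNumber G ≤ B.card :=
  Nat.sInf_le ⟨B, h, rfl⟩

theorem leakyForcingNumber_le {l : ℕ} {B : Finset V} (h : IsLeakyForcingSet G l B) :
    leakyForcingNumber G l ≤ B.card :=
  Nat.sInf_le ⟨B, h, rfl⟩

theorem IsLeakyForcingSet.isZeroForcingSet {l : ℕ} {B : Finset V}
    (h : IsLeakyForcingSet G l B) : IsZeroForcingSet G B :=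
  h ∅ (by simp)

theorem le_zeroForcingNumber {k : ℕ} (h : ∀ B : Finset V, IsZeroForcingSet G B → k ≤ B.card) :
    k ≤ zeroForcingNumber G := by
  refine le_csInf ⟨_, univ, isLeakyForcingSet_univ G 0 ∅ (by simp), rfl⟩ ?_
  rintro _ ⟨B, hB, rfl⟩
  exact h B hB

theorem zeroForcingNumber_le_leakyForcingNumber (l : ℕ) :
    zeroForcingNumber G ≤ leakyForcingNumber G l := by
  refine le_csInf ⟨_, univ, isLeakyForcingSet_univ G l, rfl⟩ ?_
  rintro _ ⟨B, hB, rfl⟩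
  exact zeroForcingNumber_le hB.isZeroForcingSet

/-- A graph without edges is resilient: only the full vertex set forces. -/
theorem isResilient_of_forall_not_adj (h : ∀ u v, ¬ G.Adj u v) (l : ℕ) : IsResilient G l := by
  refine le_antisymm ?_ (zeroForcingNumber_le_leakyForcingNumber l)
  refine le_zeroForcingNumber fun B hB => leakyForcingNumber_le ?_
  rcases Relation.ReflTransGen.cases_head hB with rfl | ⟨_, ⟨u, v, -, hf, -⟩, -⟩
  · exact isLeakyForcingSet_univ G l
  · exact absurd hf.2.1 (h u v)

/-- A vector in the kernel of a matrix supported exactly on the edges of the graph is zero as soon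
as it vanishes on a zero forcing set. -/
theorem IsZeroForcingSet.eq_zero {K : Type*} [Field K] {B : Finset V} (hB : IsZeroForcingSet G B)
    {a : V → V → K} (ha : ∀ u v, G.Adj u v → a u v ≠ 0) (ha' : ∀ u v, ¬ G.Adj u v → a u v = 0)
    {x : V → K} (hx : ∀ u, ∑ v, a u v * x v = 0) (hxB : ∀ v ∈ B, x v = 0) : x = 0 := by
  have key : ∀ C, Relation.ReflTransGen (Step G ∅) B C → ∀ v ∈ C, x v = 0 := by
    intro C hC
    induction hC with
    | refl => exact hxB
    | @tail C D _ hs ih =>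
      obtain ⟨u, v, -, ⟨-, huv, -, hw⟩, rfl⟩ := hs
      have hsum := hx u
      rw [Finset.sum_eq_single v] at hsum
      · have hv : x v = 0 := (mul_eq_zero.1 hsum).resolve_left (ha u v huv)
        intro w hwC
        rcases mem_insert.1 hwC with rfl | hwC
        · exact hv
        · exact ih w hwC
      · intro w _ hwv
        by_cases hadj : G.Adj u w
        · by_cases hwC : w ∈ C
          · rw [ih w hwC, mul_zero]
          · exact absurd (hw w hadj hwC) hwv
        · rw [ha' u w hadj, zero_mul]
      · simp
  funext v
  exact key _ hB v (mem_univ v)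

end General

end LeakyForcing

open LeakyForcing

theorem completeTimesPath_adj {n t : ℕ} {u v : Fin n × Fin t} :
    (completeTimesPath n t).Adj u v ↔
      u.1 ≠ v.1 ∧ (u.2.val + 1 = v.2.val ∨ v.2.val + 1 = u.2.val) := by
  simp [completeTimesPath, SimpleGraph.directProd, SimpleGraph.pathGraph_adj]

/-! ### Lower bounds from a matrix of small rank -/

section LowerBound

variable {n t : ℕ}

/-- The signed adjacency matrix of a path. -/
def pathSign (i j : Fin t) : ℚ :=
  if i.val + 1 = j.val then 1 else if j.val + 1 = i.val then -1 else 0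

/-- If the layer sums and first moments of `x` are killed by the signed adjacency matrix of the
path, then `x` is determined by its values on a zero forcing set. -/
theorem eq_zero_of_moments {B : Finset (Fin n × Fin t)}
    (hB : IsZeroForcingSet (completeTimesPath n t) B) {x : Fin n × Fin t → ℚ}
    (hxB : ∀ v ∈ B, x v = 0)
    (h0 : ∀ i, ∑ j, pathSign i j * ∑ g, x (g, j) = 0)
    (h1 : ∀ i, ∑ j, pathSign i j * ∑ g : Fin n, (g.val : ℚ) * x (g, j) = 0) : x = 0 := by
  refine hB.eq_zero
    -- The factor in the first coordinate vanishes exactly when the columns agree; being a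
    -- difference, it splits each row into a first moment minus a multiple of a layer sum.
    (a := fun u v => ((v.1.val : ℚ) - u.1.val) * pathSign u.2 v.2) ?_ ?_ ?_ hxB
  · intro u v huv
    rw [completeTimesPath_adj] at huv
    refine mul_ne_zero ?_ ?_
    · rw [sub_ne_zero]
      intro h
      exact huv.1 (Fin.ext (by exact_mod_cast h.symm))
    · unfold pathSign
      split_ifs <;> simp_all
  · intro u v huv
    rw [completeTimesPath_adj] at huv
    by_cases h : u.1 = v.1
    · simp [h]
    · have h2 : ¬ (u.2.val + 1 = v.2.val ∨ v.2.val + 1 = u.2.val) := fun h' => huv ⟨h, h'⟩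
      rw [not_or] at h2
      simp [pathSign, h2.1, h2.2]
  · rintro ⟨g, i⟩
    have : ∑ v : Fin n × Fin t, ((v.1.val : ℚ) - g.val) * pathSign i v.2 * x v =
        (∑ j, pathSign i j * ∑ g' : Fin n, (g'.val : ℚ) * x (g', j)) -
          g.val * ∑ j, pathSign i j * ∑ g', x (g', j) := by
      rw [Fintype.sum_prod_type_right, Finset.mul_sum, ← Finset.sum_sub_distrib]
      refine Finset.sum_congr rfl fun j _ => ?_
      simp only [Finset.mul_sum]
      rw [← Finset.sum_sub_distrib]
      exact Finset.sum_congr rfl fun g' _ => by ring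
    rw [this, h0, h1, mul_zero, sub_zero]

/-- If the kernel of the signed adjacency matrix of the path contains the common kernel of `m`
linear functionals, then zero forcing sets have at least `n * t - 2 * m` vertices. -/
theorem mul_le_card_add {m : ℕ} (φ : (Fin t → ℚ) →ₗ[ℚ] (Fin m → ℚ))
    (hφ : ∀ s, φ s = 0 → ∀ i, ∑ j, pathSign i j * s j = 0)
    {B : Finset (Fin n × Fin t)} (hB : IsZeroForcingSet (completeTimesPath n t) B) :
    n * t ≤ B.card + 2 * m := by
  by_contra hlt
  let M0 : (Fin n × Fin t → ℚ) →ₗ[ℚ] (Fin t → ℚ) :=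
    { toFun := fun x j => ∑ g, x (g, j)
      map_add' := fun x y => by ext j; simp [Finset.sum_add_distrib]
      map_smul' := fun c x => by ext j; simp [Finset.mul_sum] }
  let M1 : (Fin n × Fin t → ℚ) →ₗ[ℚ] (Fin t → ℚ) :=
    { toFun := fun x j => ∑ g : Fin n, (g.val : ℚ) * x (g, j)
      map_add' := fun x y => by ext j; simp [mul_add, Finset.sum_add_distrib]
      map_smul' := fun c x => by
        ext j
        simp only [Pi.smul_apply, smul_eq_mul, RingHom.id_apply, Finset.mul_sum]
        exact Finset.sum_congr rfl fun _ _ => by ring }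
  let R : (Fin n × Fin t → ℚ) →ₗ[ℚ] (B → ℚ) := LinearMap.funLeft ℚ ℚ Subtype.val
  -- If `n * t > B.card + 2 * m`, the `2 * m` conditions on moments and the `B.card` conditions of
  -- vanishing on `B` leave a nonzero solution.
  have hker : LinearMap.ker (((φ ∘ₗ M0).prod (φ ∘ₗ M1)).prod R) ≠ ⊥ := by
    apply LinearMap.ker_ne_bot_of_finrank_lt
    simp only [Module.finrank_prod, Module.finrank_fintype_fun_eq_card, Fintype.card_fin,
      Fintype.card_prod, Fintype.card_coe]
    omega
  obtain ⟨x, hx, hx0⟩ := Submodule.exists_mem_ne_zero_of_ne_bot hker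
  simp only [LinearMap.mem_ker, LinearMap.prod_apply, Function.prod_apply, Prod.mk_eq_zero,
    LinearMap.comp_apply] at hx
  obtain ⟨⟨hM0, hM1⟩, hR⟩ := hx
  refine hx0 (eq_zero_of_moments hB (fun v hv => ?_) (hφ _ hM0) (hφ _ hM1))
  exact congrFun hR ⟨v, hv⟩

theorem sub_two_mul_le_zeroForcingNumber :
    (n - 2) * t ≤ zeroForcingNumber (completeTimesPath n t) := by
  refine le_zeroForcingNumber fun B hB => ?_
  have := mul_le_card_add (m := t) LinearMap.id (fun s hs i => by
    have hs : s = 0 := hs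
    simp [hs]) hB
  rw [Nat.sub_mul]
  omega

/-- The kernel of the signed adjacency matrix of a path on an odd number of vertices contains the
vector that is one on the even vertices and zero on the odd ones. -/
theorem sum_pathSign_eq_zero {k : ℕ} (i : Fin (2 * k + 1)) (s : Fin (2 * k + 1) → ℚ) (c : ℚ)
    (hs : ∀ j, s j = if Even j.val then c else 0) : ∑ j, pathSign i j * s j = 0 := by
  by_cases hi : Even i.val
  · refine Finset.sum_eq_zero fun j _ => ?_
    rw [hs]
    unfold pathSign
    split_ifs <;> simp <;> grind
  -- The last index `2 * k` is even, so an odd `i` has both neighbors; they contribute `-c` and `c`.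
  · have hik : i.val + 1 < 2 * k + 1 := by
      have := i.isLt
      grind
    have hi0 : 0 < i.val := by
      rcases Nat.eq_zero_or_pos i.val with h | h
      · simp [h] at hi
      · exact h
    have hne : (⟨i.val - 1, by omega⟩ : Fin (2 * k + 1)) ≠ ⟨i.val + 1, hik⟩ := by
      simp
    rw [Fintype.sum_eq_add _ _ hne]
    · rw [hs, hs, if_pos (by grind), if_pos (by grind)]
      unfold pathSign
      rw [if_neg (by simp; omega), if_pos (by simp; omega), if_pos rfl]
      ring
    · rintro j ⟨h1, h2⟩
      have h1' : j.val ≠ i.val - 1 := fun h => h1 (Fin.ext h)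
      have h2' : j.val ≠ i.val + 1 := fun h => h2 (Fin.ext h)
      unfold pathSign
      rw [if_neg (by omega), if_neg (by omega), zero_mul]

theorem sub_two_mul_add_two_le_zeroForcingNumber (ht : Odd t) (hn : 2 ≤ n) :
    (n - 2) * t + 2 ≤ zeroForcingNumber (completeTimesPath n t) := by
  obtain ⟨k, rfl⟩ := ht
  refine le_zeroForcingNumber fun B hB => ?_
  -- The common kernel of these `2 * k` functionals is the line spanned by the indicator of the even
  -- indices, so `m = t - 1`.
  let φ : (Fin (2 * k + 1) → ℚ) →ₗ[ℚ] (Fin (2 * k) → ℚ) :=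
    { toFun := fun s j => s j.succ - if Even (j.val + 1) then s 0 else 0
      map_add' := fun x y => by
        ext j
        simp only [Pi.add_apply]
        split_ifs <;> ring
      map_smul' := fun c x => by
        ext j
        simp only [Pi.smul_apply, smul_eq_mul, RingHom.id_apply]
        split_ifs <;> ring }
  have := mul_le_card_add φ (fun s hs i => by
    refine sum_pathSign_eq_zero i s (s 0) fun j => ?_
    refine Fin.cases (by simp) (fun j => ?_) j
    have hj : s j.succ - (if Even (j.val + 1) then s 0 else 0) = 0 := congrFun hs j
    simpa using sub_eq_zero.1 hj) hB
  obtain ⟨m, rfl⟩ := Nat.exists_eq_add_of_le hn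
  rw [Nat.add_sub_cancel_left]
  rw [Nat.add_mul] at this
  omega

end LowerBound

/-! ### Forcing sets that omit at most two vertices per layer -/

section UpperBound

variable {n t : ℕ}

/-- The set of vertices of `K_n × P_t` outside the vertices `S h` of each layer `h`. -/
def outsideLayers (S : Fin t → Finset (Fin n)) : Finset (Fin n × Fin t) :=
  univ.filter fun p => p.1 ∉ S p.2

theorem mem_outsideLayers {S : Fin t → Finset (Fin n)} {p : Fin n × Fin t} :
    p ∈ outsideLayers S ↔ p.1 ∉ S p.2 := by
  simp [outsideLayers]

theorem card_outsideLayers (S : Fin t → Finset (Fin n)) :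
    (outsideLayers S).card = ∑ h, (n - (S h).card) := by
  rw [outsideLayers, Finset.card_filter, Fintype.sum_prod_type_right]
  refine Finset.sum_congr rfl fun h _ => ?_
  rw [← Finset.card_filter, Finset.filter_not, Finset.card_sdiff_of_subset (by simp)]
  simp

theorem exists_subset_singleton_of_card_le_one {α : Type*} [Nonempty α] {L : Finset α}
    (hL : L.card ≤ 1) : ∃ p, ∀ q ∈ L, q = p := by
  obtain ⟨p, hp⟩ := Finset.card_le_one_iff_subset_singleton.1 hL
  exact ⟨p, fun q hq => Finset.mem_singleton.1 (hp hq)⟩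

/-- A stalled set that contains the first layer and misses at most the vertices `a` and `b` of
each layer is everything, provided that no leak, or `n ≥ 3` and only one leak, obstructs. -/
theorem eq_univ_of_first_layer {L C : Finset (Fin n × Fin t)}
    (hC : IsStalled (completeTimesPath n t) L C) {a b : Fin n} (hab : a ≠ b)
    (h0 : ∀ g (h : Fin t), h.val = 0 → (g, h) ∈ C)
    (hout : ∀ g h, g ≠ a → g ≠ b → (g, h) ∈ C)
    (hL : L = ∅ ∨ ∃ c, c ≠ a ∧ c ≠ b ∧ ∃ p, ∀ q ∈ L, q = p) : C = univ := by
  have key : ∀ m (hm : m < t), ∀ g, (g, (⟨m, hm⟩ : Fin t)) ∈ C := by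
    intro m
    induction m using Nat.strong_induction_on with
    | _ m ih =>
      intro hm
      rcases Nat.eq_zero_or_pos m with rfl | hpos
      · exact fun g => h0 g _ rfl
      have hm' : m - 1 < t := by omega
      -- All earlier layers are full, so `(s, m - 1)` sees uncolored vertices only in layer `m`, and
      -- none in column `s`.
      have force : ∀ s v, s ≠ v → (s, (⟨m - 1, hm'⟩ : Fin t)) ∉ L →
          (∀ w, w ≠ s → w ≠ v → (w, (⟨m, hm⟩ : Fin t)) ∈ C) →
          (v, (⟨m, hm⟩ : Fin t)) ∈ C := by
        intro s v hsv hsL hw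
        refine hC (s, ⟨m - 1, hm'⟩) _ (ih _ (by omega) _ _) hsL ?_ ?_
        · rw [completeTimesPath_adj]
          exact ⟨hsv, Or.inl (by simp; omega)⟩
        · rintro ⟨w, j⟩ hadj hwC
          rw [completeTimesPath_adj] at hadj
          obtain ⟨hsw, hj⟩ := hadj
          simp only at hsw hj
          by_cases hjm : j.val < m
          · exact absurd (ih j.val hjm j.isLt w) hwC
          · obtain rfl : j = ⟨m, hm⟩ := Fin.ext (by simp; omega)
            by_contra hne
            exact hwC (hw w hsw.symm fun h => hne (by rw [h]))
      have hout' := fun g => hout g ⟨m, hm⟩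
      have hboth : (a, (⟨m, hm⟩ : Fin t)) ∈ C ∧ (b, (⟨m, hm⟩ : Fin t)) ∈ C := by
        rcases hL with rfl | ⟨c, hca, hcb, p, hp⟩
        · exact ⟨force b a hab.symm (by simp) fun w h1 h2 => hout' w h2 h1,
            force a b hab (by simp) fun w h1 h2 => hout' w h1 h2⟩
        · have hcase : ∀ s s', s ≠ s' → (s, (⟨m - 1, hm'⟩ : Fin t)) ∉ L ∨
              (s', (⟨m - 1, hm'⟩ : Fin t)) ∉ L := by
            intro s s' hss
            by_contra! hcon
            have := (hp _ hcon.1).trans (hp _ hcon.2).symm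
            exact hss (congrArg Prod.fst this)
          -- Once `v'` is colored, only `v` is missing, so both `s` and `v'` in layer `m - 1` could
          -- force it; at most one of them is a leak.
          have second : ∀ s v v', s ≠ v → v' ≠ v → s ≠ v' →
              (∀ g, g ≠ v → g ≠ v' → (g, (⟨m, hm⟩ : Fin t)) ∈ C) →
              (v', (⟨m, hm⟩ : Fin t)) ∈ C → (v, (⟨m, hm⟩ : Fin t)) ∈ C := by
            intro s v v' hsv hvv hsv' hg hv'
            have hg' : ∀ w, w ≠ v → (w, (⟨m, hm⟩ : Fin t)) ∈ C := fun w hw => by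
              by_cases h : w = v'
              · rwa [h]
              · exact hg w hw h
            rcases hcase s v' hsv' with h | h
            · exact force s v hsv h fun w _ => hg' w
            · exact force v' v hvv h fun w _ => hg' w
          rcases hcase a b hab with h | h
          · have hb := force a b hab h fun w h1 h2 => hout' w h1 h2
            exact ⟨second c a b hca hab.symm hcb hout' hb, hb⟩
          · have ha := force b a hab.symm h fun w h1 h2 => hout' w h2 h1
            exact ⟨ha, second c b a hcb hab hca (fun w h1 h2 => hout' w h2 h1) ha⟩
      intro g
      by_cases hga : g = a
      · rw [hga]; exact hboth.1
      · by_cases hgb : g = b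
        · rw [hgb]; exact hboth.2
        · exact hout' g hga hgb
  exact Finset.eq_univ_of_forall fun ⟨g, h⟩ => key h.val h.isLt g

/-- Coloring the first layer and all but two vertices of each other layer. -/
def firstLayerSet (n t : ℕ) (a b : Fin n) : Finset (Fin n × Fin t) :=
  outsideLayers fun h => if h.val = 0 then ∅ else {a, b}

theorem card_firstLayerSet {a b : Fin n} (hab : a ≠ b) (ht : 1 ≤ t) :
    (firstLayerSet n t a b).card = (n - 2) * t + 2 := by
  obtain ⟨t, rfl⟩ := Nat.exists_eq_add_of_le' ht
  have hn : 2 ≤ n := by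
    have := a.isLt
    have := b.isLt
    have : a.val ≠ b.val := fun h => hab (Fin.ext h)
    omega
  rw [firstLayerSet, card_outsideLayers, Fin.sum_univ_succ]
  simp only [Fin.val_zero, if_true, Fin.val_succ, Nat.succ_ne_zero, if_false,
    Finset.card_pair hab, Finset.card_empty, Finset.sum_const, Finset.card_univ, Fintype.card_fin,
    smul_eq_mul]
  rw [Nat.mul_comm, Nat.mul_succ]
  omega

theorem forcesAll_firstLayerSet {L : Finset (Fin n × Fin t)} {a b : Fin n} (hab : a ≠ b)
    (hL : L = ∅ ∨ ∃ c, c ≠ a ∧ c ≠ b ∧ ∃ p, ∀ q ∈ L, q = p) :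
    ForcesAll (completeTimesPath n t) L (firstLayerSet n t a b) := by
  refine forcesAll_of_stalled fun C hBC hC => eq_univ_of_first_layer hC hab ?_ ?_ hL
  · intro g h hh
    exact hBC (by simp [firstLayerSet, mem_outsideLayers, hh])
  · intro g h hga hgb
    refine hBC ?_
    rw [firstLayerSet, mem_outsideLayers]
    split_ifs <;> simp [hga, hgb]

/-- Forces by the vertices `(s, h)` with `h` in `P` suffice to color `v` in all layers in `Q`. -/
def Sweeps (L C : Finset (Fin n × Fin t)) (P Q : Fin t → Prop) : Prop :=
  ∀ s v, s ≠ v → (∀ h, P h → (s, h) ∈ C ∧ (s, h) ∉ L) →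
    (∀ h, Q h → ∀ w, w ≠ s → w ≠ v → (w, h) ∈ C) → ∀ h, Q h → (v, h) ∈ C

/-- Layer `0` sees only layer `1`; each later even layer sees one odd layer already filled and at
most one new one. This works for every `t`. -/
theorem sweeps_even_odd {L C : Finset (Fin n × Fin t)}
    (hC : IsStalled (completeTimesPath n t) L C) :
    Sweeps L C (fun h => Even h.val) (fun h => Odd h.val) := by
  intro s v hsv hP hQ
  have key : ∀ m (hm : m < t), Odd m → (v, (⟨m, hm⟩ : Fin t)) ∈ C := by
    intro m
    induction m using Nat.strong_induction_on with
    | _ m ih =>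
      intro hm hodd
      have hpos := hodd.pos
      obtain ⟨h1, h2⟩ := hP ⟨m - 1, by omega⟩ (by grind)
      refine hC _ _ h1 h2 ?_ ?_
      · rw [completeTimesPath_adj]
        exact ⟨hsv, Or.inl (by simp; omega)⟩
      · rintro ⟨w, j⟩ hadj hwC
        rw [completeTimesPath_adj] at hadj
        obtain ⟨hsw, hj⟩ := hadj
        simp only at hsw hj
        have hjodd : Odd j.val := by grind
        by_cases hwv : w = v
        · subst hwv
          by_cases hjm : j.val < m
          · exact absurd (ih j.val hjm j.isLt hjodd) hwC
          · have : j = ⟨m, hm⟩ := Fin.ext (by simp; omega)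
            rw [this]
        · exact absurd (hQ j hjodd w hsw.symm hwv) hwC
  exact fun h hh => key h.val h.isLt hh

/-- The mirror image, starting from the far end: for even `t` the last layer is odd and sees only
the one before it. -/
theorem sweeps_odd_even (ht : Even t) {L C : Finset (Fin n × Fin t)}
    (hC : IsStalled (completeTimesPath n t) L C) :
    Sweeps L C (fun h => Odd h.val) (fun h => Even h.val) := by
  intro s v hsv hP hQ
  have key : ∀ k m (hm : m < t), m + k = t → Even m → (v, (⟨m, hm⟩ : Fin t)) ∈ C := by
    intro k
    induction k using Nat.strong_induction_on with
    | _ k ih =>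
      intro m hm hmk heven
      have hm1 : m + 1 < t := by grind
      obtain ⟨h1, h2⟩ := hP ⟨m + 1, hm1⟩ (by grind)
      refine hC _ _ h1 h2 ?_ ?_
      · rw [completeTimesPath_adj]
        exact ⟨hsv, Or.inr rfl⟩
      · rintro ⟨w, j⟩ hadj hwC
        rw [completeTimesPath_adj] at hadj
        obtain ⟨hsw, hj⟩ := hadj
        simp only at hsw hj
        have hjeven : Even j.val := by grind
        by_cases hwv : w = v
        · subst hwv
          by_cases hjm : m < j.val
          · exact absurd (ih (t - j.val) (by omega) j.val j.isLt (by omega) hjeven) hwC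
          · have : j = ⟨m, hm⟩ := Fin.ext (by simp; omega)
            rw [this]
        · exact absurd (hQ j hjeven w hsw.symm hwv) hwC
  exact fun h hh => key (t - h.val) h.val h.isLt (by omega) hh

/-- If layers in `P` miss at most `b, c`, layers in `Q` miss at most `a, c`, and the only leak is
in a layer outside `Q`, then sweeping back and forth between `P` and `Q` colors all of them. -/
theorem Sweeps.eq_univ {L C : Finset (Fin n × Fin t)} {P Q : Fin t → Prop}
    (hPQ : Sweeps L C P Q) (hQP : Sweeps L C Q P) (hcover : ∀ h, P h ∨ Q h)
    {a b c : Fin n} (hab : a ≠ b) (hac : a ≠ c) (hbc : b ≠ c)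
    (hP : ∀ h, P h → ∀ w, w ≠ b → w ≠ c → (w, h) ∈ C)
    (hQ : ∀ h, Q h → ∀ w, w ≠ a → w ≠ c → (w, h) ∈ C)
    {x : Fin n} (hLQ : ∀ w h, Q h → (w, h) ∉ L) (hLx : ∀ w h, w ≠ x → (w, h) ∉ L) :
    C = univ := by
  suffices h : (∀ h, P h → ∀ w, (w, h) ∈ C) ∧ ∀ h, Q h → ∀ w, (w, h) ∈ C from
    Finset.eq_univ_of_forall fun ⟨g, i⟩ => (hcover i).elim (h.1 i · g) (h.2 i · g)
  -- Column `b` is colored and free of leaks in `Q`, and does not see its own gap in `P`.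
  have hPc : ∀ h, P h → (c, h) ∈ C := hQP b c hbc
    (fun h hh => ⟨hQ h hh b hab.symm hbc, hLQ _ _ hh⟩) hP
  -- Column `c` in `P` is now colored. If it may hold the leak, column `a` acts from `P` instead;
  -- otherwise column `c` acts.
  by_cases hxc : x = c
  · have hLP : ∀ w h, w ≠ c → (w, h) ∉ L := fun w h hw => hLx w h (hxc ▸ hw)
    have hQc : ∀ h, Q h → (c, h) ∈ C := hPQ a c hac
      (fun h hh => ⟨hP h hh a hab hac, hLP _ _ hac⟩) hQ
    have hPb : ∀ h, P h → (b, h) ∈ C := hQP c b hbc.symm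
      (fun h hh => ⟨hQc h hh, hLQ _ _ hh⟩) (fun h hh w h1 h2 => hP h hh w h2 h1)
    have hQa : ∀ h, Q h → (a, h) ∈ C := hPQ b a hab.symm
      (fun h hh => ⟨hPb h hh, hLP _ _ hbc⟩) (fun h hh w _ h2 => by
        by_cases hwc : w = c
        · exact hwc ▸ hQc h hh
        · exact hQ h hh w h2 hwc)
    grind
  · have hQa : ∀ h, Q h → (a, h) ∈ C := hPQ c a hac.symm
      (fun h hh => ⟨hPc h hh, hLx _ _ (Ne.symm hxc)⟩) (fun h hh w h1 h2 => hQ h hh w h2 h1)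
    have hPb : ∀ h, P h → (b, h) ∈ C := hQP a b hab
      (fun h hh => ⟨hQa h hh, hLQ _ _ hh⟩) (fun h hh w _ h2 => by
        by_cases hwc : w = c
        · exact hwc ▸ hPc h hh
        · exact hP h hh w h2 hwc)
    -- Columns `a` and `b` are both colored in `P`, and at most one of them is the leak's column
    -- `x`.
    obtain ⟨s, hsc, hsx, hsP⟩ : ∃ s, s ≠ c ∧ s ≠ x ∧ ∀ h, P h → (s, h) ∈ C := by
      by_cases hxa : a = x
      · exact ⟨b, hbc, fun h => hab (hxa.trans h.symm), hPb⟩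
      · exact ⟨a, hac, hxa, fun h hh => hP h hh a hab hac⟩
    have hQc : ∀ h, Q h → (c, h) ∈ C := hPQ s c hsc
      (fun h hh => ⟨hsP h hh, hLx _ _ hsx⟩) (fun h hh w _ h2 => by
        by_cases hwa : w = a
        · exact hwa ▸ hQa h hh
        · exact hQ h hh w hwa h2)
    grind

/-- Coloring all but `b, c` in even layers and all but `a, c` in odd layers. -/
def alternatingSet (n t : ℕ) (a b c : Fin n) : Finset (Fin n × Fin t) :=
  outsideLayers fun h => if Even h.val then {b, c} else {a, c}

theorem card_alternatingSet {a b c : Fin n} (hac : a ≠ c) (hbc : b ≠ c) :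
    (alternatingSet n t a b c).card = (n - 2) * t := by
  rw [alternatingSet, card_outsideLayers, Finset.sum_congr rfl (g := fun _ => n - 2)]
  · simp [Nat.mul_comm]
  · intro h _
    split_ifs
    · rw [Finset.card_pair hbc]
    · rw [Finset.card_pair hac]

/-- The parity class of layers avoiding the leak plays `Q`. Exchanging the classes exchanges `a` and
`b`, and both cases are the same argument. -/
theorem isLeakyForcingSet_alternatingSet (ht : Even t) (ht0 : 1 ≤ t) {a b c : Fin n}
    (hab : a ≠ b) (hac : a ≠ c) (hbc : b ≠ c) :
    IsLeakyForcingSet (completeTimesPath n t) 1 (alternatingSet n t a b c) := by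
  intro L hL
  have : Nonempty (Fin n × Fin t) := ⟨(a, ⟨0, ht0⟩)⟩
  obtain ⟨⟨x, l⟩, hp⟩ := exists_subset_singleton_of_card_le_one hL
  refine forcesAll_of_stalled fun C hBC hC => ?_
  have hE : ∀ h : Fin t, Even h.val → ∀ w, w ≠ b → w ≠ c → (w, h) ∈ C := by
    intro h hh w hwb hwc
    exact hBC (by simp [alternatingSet, mem_outsideLayers, hh, hwb, hwc])
  have hO : ∀ h : Fin t, Odd h.val → ∀ w, w ≠ a → w ≠ c → (w, h) ∈ C := by
    intro h hh w hwa hwc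
    exact hBC (by simp [alternatingSet, mem_outsideLayers, Nat.not_even_iff_odd.2 hh, hwa, hwc])
  have hLx : ∀ w h, w ≠ x → (w, h) ∉ L := fun w h hw hL => hw (congrArg Prod.fst (hp _ hL))
  have hLl : ∀ w h, h ≠ l → (w, h) ∉ L := fun w h hw hL => hw (congrArg Prod.snd (hp _ hL))
  rcases Nat.even_or_odd l.val with hl | hl
  · refine (sweeps_even_odd hC).eq_univ (sweeps_odd_even ht hC) (fun h => Nat.even_or_odd h.val)
      hab hac hbc hE hO (fun w h hh => hLl w h ?_) hLx
    rintro rfl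
    exact Nat.not_even_iff_odd.2 hh hl
  · refine (sweeps_odd_even ht hC).eq_univ (sweeps_even_odd hC)
      (fun h => (Nat.even_or_odd h.val).symm) hab.symm hbc hac hO hE
      (fun w h hh => hLl w h ?_) hLx
    rintro rfl
    exact Nat.not_even_iff_odd.2 hl hh

end UpperBound

/-! ### Numerical bounds and the theorem -/

section Values

variable {n t : ℕ}

theorem leakyForcingNumber_le_of_even (ht : Even t) (ht0 : 1 ≤ t) (hn : 3 ≤ n) :
    leakyForcingNumber (completeTimesPath n t) 1 ≤ (n - 2) * t := by
  have hac : (⟨0, by omega⟩ : Fin n) ≠ ⟨2, by omega⟩ := by simp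
  have hbc : (⟨1, by omega⟩ : Fin n) ≠ ⟨2, by omega⟩ := by simp
  rw [← card_alternatingSet (t := t) hac hbc]
  exact leakyForcingNumber_le (isLeakyForcingSet_alternatingSet ht ht0 (by simp) hac hbc)

theorem leakyForcingNumber_le_of_three_le (ht : 1 ≤ t) (hn : 3 ≤ n) :
    leakyForcingNumber (completeTimesPath n t) 1 ≤ (n - 2) * t + 2 := by
  have hab : (⟨0, by omega⟩ : Fin n) ≠ ⟨1, by omega⟩ := by simp
  rw [← card_firstLayerSet hab ht]
  refine leakyForcingNumber_le fun L hL => forcesAll_firstLayerSet hab (Or.inr ?_)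
  have : Nonempty (Fin n × Fin t) := ⟨(⟨0, by omega⟩, ⟨0, ht⟩)⟩
  exact ⟨⟨2, by omega⟩, by simp, by simp, exists_subset_singleton_of_card_le_one hL⟩

theorem zeroForcingNumber_le_of_two_le (ht : 1 ≤ t) (hn : 2 ≤ n) :
    zeroForcingNumber (completeTimesPath n t) ≤ (n - 2) * t + 2 := by
  have hab : (⟨0, by omega⟩ : Fin n) ≠ ⟨1, by omega⟩ := by simp
  rw [← card_firstLayerSet hab ht]
  exact zeroForcingNumber_le (forcesAll_firstLayerSet hab (Or.inl rfl))

end Values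

theorem theorem2p1 (n t : ℕ) (hn : 1 ≤ n) (ht : 1 ≤ t) :
    (¬ (n = 2 ∧ 2 ≤ t) → LeakyForcing.IsResilient (completeTimesPath n t) 1) ∧
    (Even t → 3 ≤ n →
      LeakyForcing.zeroForcingNumber (completeTimesPath n t) = (n - 2) * t ∧
      LeakyForcing.leakyForcingNumber (completeTimesPath n t) 1 = (n - 2) * t) ∧
    (Odd t → 2 ≤ n →
      LeakyForcing.zeroForcingNumber (completeTimesPath n t) = (n - 2) * t + 2 ∧
      (¬ (n = 2 ∧ 2 ≤ t) →
        LeakyForcing.leakyForcingNumber (completeTimesPath n t) 1 = (n - 2) * t + 2)) := by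
  have hle : zeroForcingNumber (completeTimesPath n t) ≤
      leakyForcingNumber (completeTimesPath n t) 1 := zeroForcingNumber_le_leakyForcingNumber 1
  have heven : Even t → 3 ≤ n →
      zeroForcingNumber (completeTimesPath n t) = (n - 2) * t ∧
      leakyForcingNumber (completeTimesPath n t) 1 = (n - 2) * t := by
    intro he h3
    have h1 := leakyForcingNumber_le_of_even he ht h3
    have h2 := sub_two_mul_le_zeroForcingNumber (n := n) (t := t)
    omega
  have hodd : Odd t → 2 ≤ n →
      zeroForcingNumber (completeTimesPath n t) = (n - 2) * t + 2 := fun ho h2 =>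
    le_antisymm (zeroForcingNumber_le_of_two_le ht h2)
      (sub_two_mul_add_two_le_zeroForcingNumber ho h2)
  have hres : ¬ (n = 2 ∧ 2 ≤ t) → IsResilient (completeTimesPath n t) 1 := by
    intro hne
    rcases Nat.lt_or_ge n 3 with hn3 | hn3
    -- Here `n = 1`, or `n = 2` and `t = 1`: there are no edges.
    · refine isResilient_of_forall_not_adj (fun u v huv => ?_) 1
      rw [completeTimesPath_adj] at huv
      by_cases hn1 : n = 1
      · subst hn1
        exact huv.1 (Subsingleton.elim _ _)
      · have := u.2.isLt
        have := v.2.isLt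
        omega
    · rcases Nat.even_or_odd t with he | ho
      · exact (heven he hn3).2.trans (heven he hn3).1.symm
      · refine le_antisymm ?_ hle
        rw [hodd ho (by omega)]
        exact leakyForcingNumber_le_of_three_le ht hn3
  refine ⟨hres, heven, fun ho h2 => ⟨hodd ho h2, fun hne => ?_⟩⟩
  exact (hres hne).trans (hodd ho h2)
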